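/- Let $n$ be a natural number, let $M_n$ be the algebra of all $n\times n$ complex matrices, $M_n^{-1}$ the group of invertible matrices in $M_n$, and $E$ the identity matrix. For $M\in M_n$ let $M^t$ be the transpose and $\overline{M}$ the entrywise complex conjugate of $M$. Let $\|\cdot\|$ and $\|\cdot\|'$ be any two matrix norms on $M_n$, i.e. submultiplicative norms on the complex vector space $M_n$ (not necessarily taking the value $1$ at $E$). Let $\mathfrak{A}$ and $\mathfrak{B}$ be open subgroups of $M_n^{-1}$, and let $S$ be a surjection from $\mathfrak{A}$ onto $\mathfrak{B}$ such that $\|S(M)-S(N)\|'=\|M-N\|$ for all $M,N\in\mathfrak{A}$. Then there exists an invertible matrix $U\in M_n$ such that one of the following holds: 1. $S(M)=S(E)\,U M U^{-1}$ for all $M\in\mathfrak{A}$; 2. $S(M)=S(E)\,U M^t U^{-1}$ for all $M\in\mathfrak{A}$; 3. $S(M)=S(E)\,U \overline{M} U^{-1}$ for all $M\in\mathfrak{A}$; 4. $S(M)=S(E)\,U \overline{M}^{\,t} U^{-1}$ for all $M\in\mathfrak{A}$. In particular, if $S$ is unital, i.e. $S(E)=E$, then $S$ is multiplicative ($S(MN)=S(M)S(N)$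 for all $M,N\in\mathfrak{A}$) or anti-multiplicative ($S(MN)=S(N)S(M)$ for all $M,N\in\mathfrak{A}$). -/

import Mathlib

open scoped Matrix MatrixGroups

/-! An open subgroup of the general linear group is the whole group, and invertible matrices are
dense, so by completeness and Mazur–Ulam `S` is the restriction of a real-affine bijection `A ↦ T A
+ c`. This bijection maps invertible matrices to invertible ones and singular to singular; if `c ≠
0`, halving a suitable singular matrix would violate this, so `S` is the restriction of a
real-linear `T` (`exists_linearEquiv_of_isometry`).

Such a `T` preserves rank at most one, because a rank-one direction is one along which every real
line through an invertible matrix has at most one singular point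
(`isOuterProduct_map_of_det_ne_zero_iff`). For `n ≥ 2`, multiplying by `S(E)⁻¹` makes `T` unital;
the metric is no longer needed. A conjugation makes `T` fix the diagonal matrix units, and vanishing
2×2 minors then determine it up to a diagonal conjugation, transposition and complex conjugation
(`exists_conj_of_det_ne_zero_iff`). For `n = 1` every real-linear bijection preserves invertibility,
so there the isometry condition is used instead (`eq_mul_or_mul_conj_of_unique`). -/

/-- Two dense families in complete metric spaces with the same mutual distances are matched by an
isometric bijection of the ambient spaces. -/
theorem exists_isometryEquiv_of_denseRange {ι E F : Type*} [MetricSpace E] [CompleteSpace E]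
    [MetricSpace F] [CompleteSpace F] {a : ι → E} {b : ι → F}
    (ha : DenseRange a) (hb : DenseRange b)
    (hab : ∀ i j, dist (b i) (b j) = dist (a i) (a j)) :
    ∃ e : E ≃ᵢ F, ∀ i, e (a i) = b i := by
  let _ : PseudoMetricSpace ι := PseudoMetricSpace.induced a inferInstance
  have ia : Isometry a := Isometry.of_dist_eq fun _ _ => rfl
  have ib : Isometry b := Isometry.of_dist_eq fun i j => hab i j
  let hd := ia.isUniformInducing.isDenseInducing ha
  have hc : Continuous (hd.extend b) :=
    (uniformContinuous_uniformly_extend ia.isUniformInducing ha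
      ib.uniformContinuous).continuous
  have hext : ∀ i, hd.extend b (a i) = b i :=
    uniformly_extend_of_ind ia.isUniformInducing ha ib.uniformContinuous
  have hiso : Isometry (hd.extend b) := by
    refine Isometry.of_dist_eq fun x y => ?_
    refine ha.induction_on₂ (p := fun x y => dist (hd.extend b x) (hd.extend b y) = dist x y)
      ?_ ?_ x y
    · exact isClosed_eq ((hc.comp continuous_fst).dist (hc.comp continuous_snd)) continuous_dist
    · intro i j
      rw [hext, hext, hab]
  have hsurj : Function.Surjective (hd.extend b) := by
    have hdense : Dense (Set.range (hd.extend b)) :=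
      hb.mono (by rintro _ ⟨i, rfl⟩; exact ⟨a i, hext i⟩)
    rw [← Set.range_eq_univ, ← hiso.isClosedEmbedding.isClosed_range.closure_eq,
      hdense.closure_eq]
  exact ⟨IsometryEquiv.mk (Equiv.ofBijective _ ⟨hiso.injective, hsurj⟩) hiso, hext⟩

/-- A surjective isometry between dense families of two complete real normed spaces is the
restriction of an affine bijection. -/
theorem exists_affine_of_denseRange {ι E F : Type*}
    [NormedAddCommGroup E] [NormedSpace ℝ E] [CompleteSpace E]
    [NormedAddCommGroup F] [NormedSpace ℝ F] [CompleteSpace F] {a : ι → E} {b : ι → F}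
    (ha : DenseRange a) (hb : DenseRange b)
    (hab : ∀ i j, ‖b i - b j‖ = ‖a i - a j‖) :
    ∃ (T : E ≃ₗ[ℝ] F) (c : F), (∀ x, ‖T x‖ = ‖x‖) ∧ ∀ i, T (a i) + c = b i := by
  obtain ⟨e, he⟩ := exists_isometryEquiv_of_denseRange ha hb
    (fun i j => by rw [dist_eq_norm, dist_eq_norm, hab])
  refine ⟨e.toRealAffineIsometryEquiv.linearIsometryEquiv.toLinearEquiv, e 0,
    fun x => e.toRealAffineIsometryEquiv.linearIsometryEquiv.norm_map x, fun i => ?_⟩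
  have := e.toRealAffineIsometryEquiv.map_vadd 0 (a i)
  simp only [vadd_eq_add, add_zero, IsometryEquiv.coeFn_toRealAffineIsometryEquiv] at this
  rw [← he i, this]
  rfl

/-- Mazur–Ulam for dense families in a finite-dimensional space, the norms being given as
functions. -/
theorem exists_affine_of_addGroupNorm {ι V W : Type*}
    [AddCommGroup V] [Module ℝ V] [FiniteDimensional ℝ V]
    [AddCommGroup W] [Module ℝ W] [FiniteDimensional ℝ W]
    (p : AddGroupNorm V) (q : AddGroupNorm W) (hp : ∀ (r : ℝ) x, p (r • x) = |r| * p x)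
    (hq : ∀ (r : ℝ) x, q (r • x) = |r| * q x) {a : ι → V} {b : ι → W}
    (ha : ∀ x, ∀ ε > 0, ∃ i, p (x - a i) < ε) (hb : ∀ x, ∀ ε > 0, ∃ i, q (x - b i) < ε)
    (hab : ∀ i j, q (b i - b j) = p (a i - a j)) :
    ∃ (T : V ≃ₗ[ℝ] W) (c : W), (∀ x, q (T x) = p x) ∧ ∀ i, T (a i) + c = b i := by
  let _ : NormedAddCommGroup V := p.toNormedAddCommGroup
  let _ : NormedAddCommGroup W := q.toNormedAddCommGroup
  let _ : NormedSpace ℝ V := ⟨fun r x => (hp r x).le⟩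
  let _ : NormedSpace ℝ W := ⟨fun r x => (hq r x).le⟩
  have : CompleteSpace V := FiniteDimensional.complete ℝ V
  have : CompleteSpace W := FiniteDimensional.complete ℝ W
  refine exists_affine_of_denseRange (a := a) (b := b) ?_ ?_ hab
  · refine Metric.denseRange_iff.2 fun x ε hε => ?_
    obtain ⟨i, hi⟩ := ha x ε hε
    exact ⟨i, by rw [dist_eq_norm]; exact hi⟩
  · refine Metric.denseRange_iff.2 fun x ε hε => ?_
    obtain ⟨i, hi⟩ := hb x ε hε
    exact ⟨i, by rw [dist_eq_norm]; exact hi⟩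

/-! ### Density of invertible matrices, and their open subgroups. -/

namespace Matrix

variable {n : Type*} [Fintype n] [DecidableEq n]

theorem finite_setOf_det_smul_add_eq_zero {A B : Matrix n n ℂ} {w : ℂ}
    (hw : (w • B + A).det ≠ 0) :
    {z : ℂ | (z • B + A).det = 0}.Finite := by
  let p : Polynomial ℂ := ((Polynomial.X : Polynomial ℂ) • B.map Polynomial.C
    + A.map Polynomial.C).det
  have hp : ∀ z, p.eval z = (z • B + A).det := fun z => by
    rw [← Polynomial.coe_evalRingHom, RingHom.map_det]
    congr 1
    ext i j
    simp [mul_comm z]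
  have hp0 : p ≠ 0 := by
    intro h
    apply hw
    rw [← hp, h, Polynomial.eval_zero]
  refine (p.roots.toFinset.finite_toSet).subset fun z hz => ?_
  simp only [Finset.mem_coe, Multiset.mem_toFinset, Polynomial.mem_roots hp0, Polynomial.IsRoot,
    hp]
  exact hz

/-- Invertible matrices are dense for every norm. -/
theorem exists_GL_sub_lt (ν : AlgebraNorm ℂ (Matrix n n ℂ)) (A : Matrix n n ℂ) {ε : ℝ}
    (hε : 0 < ε) : ∃ g : GL n ℂ, ν (A - g.val) < ε := by
  have hfin : {z : ℂ | (A + z • 1).det = 0}.Finite := by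
    refine ((-A).charpoly.roots.toFinset.finite_toSet).subset fun z hz => ?_
    simp only [Finset.mem_coe, Multiset.mem_toFinset,
      Polynomial.mem_roots (-A).charpoly_monic.ne_zero, Polynomial.IsRoot, eval_charpoly]
    rw [sub_neg_eq_add, add_comm, scalar_apply, ← smul_one_eq_diagonal]
    exact hz
  -- The `+ 1` keeps the divisor positive even for empty `n`, where `1 = 0`.
  have hpos : 0 < ν 1 + 1 := add_pos_of_nonneg_of_pos (apply_nonneg ν 1) one_pos
  obtain ⟨r, hr, hrz⟩ := (Set.Ioo_infinite (div_pos hε hpos)).exists_notMem_finite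
    (hfin.preimage (f := ((↑) : ℝ → ℂ)) Complex.ofReal_injective.injOn)
  refine ⟨GeneralLinearGroup.mkOfDetNeZero (A + (r : ℂ) • 1) hrz, ?_⟩
  have hsub : A - (A + (r : ℂ) • 1) = -((r : ℂ) • 1) := by abel
  change ν (A - (A + (r : ℂ) • 1)) < ε
  rw [hsub, map_neg_eq_map, map_smul_eq_mul, Complex.norm_of_nonneg hr.1.le]
  calc r * ν 1 ≤ r * (ν 1 + 1) := by
        gcongr
        · exact hr.1.le
        · linarith
    _ < ε := (lt_div_iff₀ hpos).1 hr.2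

/-- An open subgroup of the general linear group is everything, since every element is joined to
`1` inside the complex line through both, from which finitely many points are removed. -/
theorem mem_openSubgroup_GL (H : OpenSubgroup (GL n ℂ)) (g : GL n ℂ) : g ∈ H := by
  let f : ℂ → Matrix n n ℂ := fun z => z • (g.val - 1) + 1
  let Z : Set ℂ := {z | (f z).det = 0}
  have h0 : (f 0).det ≠ 0 := by simp [f]
  have h1 : (f 1).det ≠ 0 := by
    simpa [f] using (Matrix.isUnit_iff_isUnit_det _).1 g.isUnit
  have hZ : Z.Finite := finite_setOf_det_smul_add_eq_zero h0
  have hconn : IsConnected Zᶜ :=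
    hZ.countable.isConnected_compl_of_one_lt_rank (by simp [Complex.rank_real_complex])
  let γ : ↥(Zᶜ) → GL n ℂ := fun z => GeneralLinearGroup.mkOfDetNeZero (f z) z.2
  have hf : Continuous f := by fun_prop
  have hγ : Continuous γ := by
    rw [Units.continuous_iff]
    refine ⟨hf.comp continuous_subtype_val, ?_⟩
    have : (fun z : ↥(Zᶜ) => ((γ z)⁻¹).val) = fun z : ↥(Zᶜ) => (f z)⁻¹ := by
      ext1 z
      rw [coe_units_inv]
      rfl
    rw [this, continuous_iff_continuousAt]
    intro z
    refine ContinuousAt.comp (g := Inv.inv) (continuousAt_matrix_inv _ ?_)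
      (hf.comp continuous_subtype_val).continuousAt
    obtain ⟨u, hu⟩ : IsUnit (f z).det := isUnit_iff_ne_zero.2 z.2
    rw [← hu]
    exact NormedRing.inverse_continuousAt u
  have : PreconnectedSpace ↥(Zᶜ) := Subtype.preconnectedSpace hconn.isPreconnected
  have hclopen : IsClopen (γ ⁻¹' (H : Set (GL n ℂ))) := H.isClopen.preimage hγ
  have huniv := hclopen.eq_univ ⟨⟨0, h0⟩, by
    have : γ ⟨0, h0⟩ = 1 := by ext1; simp [γ, f, GeneralLinearGroup.mkOfDetNeZero]
    simp [this, one_mem]⟩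
  have hmem : (⟨1, h1⟩ : ↥(Zᶜ)) ∈ γ ⁻¹' (H : Set (GL n ℂ)) := huniv ▸ Set.mem_univ _
  have hg : γ ⟨1, h1⟩ = g := by ext1; simp [γ, f, GeneralLinearGroup.mkOfDetNeZero]
  rw [Set.mem_preimage, hg] at hmem
  exact hmem

end Matrix

/-! ### Rank-one matrices and preservers of invertibility. -/

namespace Matrix

/-- A matrix is a product of a column and a row, i.e. has rank at most one. -/
def IsOuterProduct {n K : Type*} [Field K] (A : Matrix n n K) : Prop := ∃ x y, A = vecMulVec x y

theorem IsOuterProduct.cross {n K : Type*} [Field K] {A : Matrix n n K} (hA : IsOuterProduct A) (i j k l : n) :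
    A i j * A k l = A i l * A k j := by
  obtain ⟨x, y, rfl⟩ := hA
  simp only [vecMulVec_apply]
  ring

section Field

variable {n K : Type*} [Fintype n] [DecidableEq n] [Field K]

/-- The isomorphism between the two spans extends to an automorphism of the whole finite-dimensional
space. -/
theorem exists_det_ne_zero_mulVec_eq {ι : Type*} [Finite ι] {v w : ι → n → K}
    (hv : LinearIndependent K v) (hw : LinearIndependent K w) :
    ∃ C : Matrix n n K, C.det ≠ 0 ∧ ∀ i, C *ᵥ v i = w i := by
  let f := hv.linearCombinationEquiv.symm ≪≫ₗ hw.linearCombinationEquiv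
  have : FiniteDimensional K (Submodule.span K (Set.range v)) :=
    FiniteDimensional.span_of_finite K (Set.finite_range _)
  obtain ⟨g, hg⟩ := Submodule.exists_linearEquiv_restrict_eq f
  refine ⟨LinearMap.toMatrix' g.toLinearMap, ?_, fun i => ?_⟩
  · rw [← isUnit_iff_ne_zero, LinearMap.det_toMatrix']
    exact g.isUnit_det'
  · have h1 : ((hv.linearCombinationEquiv (Finsupp.single i 1) :
        Submodule.span K (Set.range v)) : n → K) = v i := by simp
    rw [LinearMap.toMatrix'_mulVec, LinearEquiv.coe_coe, ← h1, ← hg]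
    simp [f]

/-- If `V ≠ 0`, some singular matrix becomes invertible after adding `V`. -/
theorem exists_det_eq_zero_det_add_ne_zero {V : Matrix n n K} (hV : V ≠ 0) :
    ∃ X : Matrix n n K, X.det = 0 ∧ (X + V).det ≠ 0 := by
  obtain ⟨v, hv⟩ : ∃ v, V *ᵥ v ≠ 0 := by
    by_contra! h
    exact hV (Matrix.ext_of_mulVec_single fun i => by rw [h, zero_mulVec])
  have hv0 : v ≠ 0 := by rintro rfl; simp at hv
  -- As `C` agrees with `V` at `v`, the matrix `C - V` kills `v`, while adding `V` restores `C`.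
  obtain ⟨C, hC, hCv⟩ := exists_det_ne_zero_mulVec_eq (ι := Unit) (v := fun _ => v)
    (w := fun _ => V *ᵥ v) (LinearIndependent.of_subsingleton () hv0)
    (LinearIndependent.of_subsingleton () hv)
  refine ⟨C - V, ?_, by simpa using hC⟩
  exact exists_mulVec_eq_zero_iff.1 ⟨v, hv0, by rw [sub_mulVec, hCv (), sub_self]⟩

theorem isOuterProduct_of_not_linearIndependent {A : Matrix n n K}
    (h : ∀ v w, ¬ LinearIndependent K ![A *ᵥ v, A *ᵥ w]) : IsOuterProduct A := by
  by_cases hA : ∃ j, A.col j ≠ 0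
  · obtain ⟨j, hj⟩ := hA
    have hk : ∀ k, ∃ c : K, c • A.col j = A.col k := by
      intro k
      have := h (Pi.single j 1) (Pi.single k 1)
      rw [mulVec_single_one, mulVec_single_one, LinearIndependent.pair_iff' hj] at this
      push Not at this
      exact this
    choose c hc using hk
    refine ⟨A.col j, c, ?_⟩
    ext i k
    have := congrFun (hc k) i
    simp only [Pi.smul_apply, col_apply, smul_eq_mul] at this
    rw [vecMulVec_apply, col_apply, ← this, mul_comm]
  · push Not at hA
    refine ⟨0, 0, ?_⟩
    ext i j
    simpa using congrFun (hA j) i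

/-- By the matrix determinant lemma, the determinant is affine in the scalar and nonzero at `0`, so
it has at most one root. -/
theorem eq_of_det_add_smul_vecMulVec_eq_zero {C : Matrix n n K} (hC : C.det ≠ 0) {x y : n → K}
    {s t : K} (hs : (C + s • vecMulVec x y).det = 0) (ht : (C + t • vecMulVec x y).det = 0) :
    s = t := by
  have key : ∀ r : K, (C + r • vecMulVec x y).det = C.det * (1 + r * (y ⬝ᵥ C⁻¹ *ᵥ x)) := by
    intro r
    rw [← smul_vecMulVec, vecMulVec_eq Unit,
      det_add_replicateCol_mul_replicateRow (isUnit_iff_ne_zero.2 hC),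
      det_unique (n := Unit),
      add_apply, one_apply_eq, Matrix.mul_assoc, ← replicateCol_mulVec,
      replicateRow_mul_replicateCol_apply, mulVec_smul, dotProduct_smul, smul_eq_mul]
  rw [key, mul_eq_zero, or_iff_right hC] at hs ht
  have hne : y ⬝ᵥ C⁻¹ *ᵥ x ≠ 0 := by
    intro h
    simp [h] at hs
  exact mul_right_cancel₀ hne (add_left_cancel (hs.trans ht.symm))

end Field

variable {n : Type*} [Fintype n] [DecidableEq n]

/-- A real-linear bijection preserving invertibility in both directions preserves matrices of rank
at most one: these are the directions along which every real line through an invertible matrix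
meets the singular matrices at most once. -/
theorem isOuterProduct_map_of_det_ne_zero_iff {T : Matrix n n ℂ ≃ₗ[ℝ] Matrix n n ℂ}
    (hT : ∀ A, (T A).det ≠ 0 ↔ A.det ≠ 0) {A : Matrix n n ℂ} (hA : IsOuterProduct A) :
    IsOuterProduct (T A) := by
  obtain ⟨x, y, rfl⟩ := hA
  apply isOuterProduct_of_not_linearIndependent
  intro v w hind
  set B := T (vecMulVec x y) with hB
  have hind' : LinearIndependent ℂ ![v, w] := by
    refine LinearIndependent.of_comp B.mulVecLin ?_
    have : B.mulVecLin ∘ ![v, w] = ![B *ᵥ v, B *ᵥ w] := by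
      ext i : 1
      fin_cases i <;> simp
    rw [this]
    exact hind
  -- The factor `2` makes `C + r • B` singular at two distinct real values, `r = -1` (killing `v`)
  -- and `r = -2` (killing `w`).
  have hind2 : LinearIndependent ℂ ![B *ᵥ v, (2 : ℂ) • B *ᵥ w] := by
    rw [LinearIndependent.pair_iff] at hind ⊢
    intro s t h
    have := hind s (t * 2) (by rw [mul_smul]; exact h)
    simpa using this
  obtain ⟨C, hC, hCv⟩ := exists_det_ne_zero_mulVec_eq hind' hind2
  have h0 : C *ᵥ v = B *ᵥ v := hCv 0
  have h1 : C *ᵥ w = (2 : ℂ) • B *ᵥ w := hCv 1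
  have hv : v ≠ 0 := hind'.ne_zero 0
  have hw : w ≠ 0 := hind'.ne_zero 1
  have key : ∀ r : ℝ, (C + (r : ℂ) • B).det = 0 →
      (T.symm C + (r : ℂ) • vecMulVec x y).det = 0 := by
    intro r hr
    by_contra hne
    refine (hT _).2 hne ?_
    rw [map_add, T.apply_symm_apply, Complex.coe_smul, map_smul, ← hB, ← Complex.coe_smul]
    exact hr
  have hs := key (-1) (exists_mulVec_eq_zero_iff.1 ⟨v, hv, by
    rw [add_mulVec, smul_mulVec, h0]; simp⟩)
  have ht := key (-2) (exists_mulVec_eq_zero_iff.1 ⟨w, hw, by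
    rw [add_mulVec, smul_mulVec, h1]; simp⟩)
  have hC' : (T.symm C).det ≠ 0 := by rw [← hT, T.apply_symm_apply]; exact hC
  have := eq_of_det_add_smul_vecMulVec_eq_zero hC' hs ht
  norm_num at this

/-- A real-affine bijection under which invertibility is preserved in both directions is linear. -/
theorem translation_eq_zero_of_det_ne_zero_iff {T : Matrix n n ℂ ≃ₗ[ℝ] Matrix n n ℂ}
    {c : Matrix n n ℂ} (hT : ∀ A, (T A + c).det ≠ 0 ↔ A.det ≠ 0) : c = 0 := by
  by_contra hc
  obtain ⟨X, hX, hXc⟩ := exists_det_eq_zero_det_add_ne_zero hc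
  have h1 : (T.symm (X - c)).det = 0 := by
    by_contra hne
    have := (hT _).2 hne
    rw [T.apply_symm_apply, sub_add_cancel] at this
    exact this hX
  -- Halving the singular `T.symm (X - c)` keeps it singular, but its affine image is half of the
  -- invertible `X + c`.
  have h2 : T ((1 / 2 : ℝ) • T.symm (X - c)) + c = (1 / 2 : ℂ) • (X + c) := by
    rw [map_smul, T.apply_symm_apply]
    ext i j
    simp
    ring
  refine (hT ((1 / 2 : ℝ) • T.symm (X - c))).1 ?_ ?_
  · rw [h2, det_smul]
    exact mul_ne_zero (by simp) hXc
  · rw [← Complex.coe_smul, det_smul, h1, mul_zero]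

end Matrix

/-! ### Rank-one preservers that fix the diagonal matrix units. -/

theorem Complex.eq_id_or_conj_of_map_I_sq {σ : ℂ →ₗ[ℝ] ℂ} (h1 : σ 1 = 1)
    (hI : σ I * σ I = -1) : (∀ z, σ z = z) ∨ (∀ z, σ z = starRingEnd ℂ z) := by
  have hz : ∀ z, σ z = z.re + z.im * σ I := by
    intro z
    have : z = z.re • (1 : ℂ) + z.im • I := by
      simp [Complex.re_add_im]
    conv_lhs => rw [this]
    rw [map_add, map_smul, map_smul, h1]
    simp
  have hcases : σ I = I ∨ σ I = -I := by
    rw [← mul_self_eq_mul_self_iff, hI, Complex.I_mul_I]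
  refine hcases.imp (fun h z => ?_) (fun h z => ?_)
  · rw [hz, h, Complex.re_add_im]
  · rw [hz, h]
    apply Complex.ext <;> simp

namespace Matrix

/-- Entrywise real-linear maps preserving rank-one matrices and fixing the diagonal units come from
the identity or complex conjugation, up to conjugation by a diagonal matrix. -/
theorem exists_diagonal_of_cross {n : Type*} [DecidableEq n] [Nontrivial n]
    {φ : n → n → ℂ →ₗ[ℝ] ℂ} (h1 : ∀ i, φ i i 1 = 1)
    (hφ : ∀ (x y : n → ℂ) (i j k l : n), φ i j (x i * y j) * φ k l (x k * y l) =
      φ i l (x i * y l) * φ k j (x k * y j)) :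
    ∃ d : n → ℂ, (∀ i, d i ≠ 0) ∧ ((∀ i j z, φ i j z = d i * z * (d j)⁻¹) ∨
      (∀ i j z, φ i j z = d i * starRingEnd ℂ z * (d j)⁻¹)) := by
  have cross : ∀ (i k : n) (p q r s : ℂ), i ≠ k →
      φ i i (p * r) * φ k k (q * s) = φ i k (p * s) * φ k i (q * r) := by
    intro i k p q r s hik
    have := hφ (fun a => if a = i then p else q) (fun a => if a = i then r else s) i i k k
    simpa [hik.symm] using this
  have hα : ∀ i j k : n, φ i j 1 * φ k k 1 = φ i k 1 * φ k j 1 := by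
    intro i j k
    simpa using hφ (fun _ => 1) (fun _ => 1) i j k k
  have hinv : ∀ i k, φ i k 1 * φ k i 1 = 1 := by
    intro i k
    rw [← hα, h1, h1, mul_one]
  have hdiag : ∀ i k z, φ i i z = φ k k z := by
    intro i k z
    rcases eq_or_ne i k with rfl | hik
    · rfl
    have e1 := cross i k 1 1 z 1 hik
    have e2 := cross i k 1 z 1 1 hik
    simp only [one_mul, mul_one, h1] at e1 e2
    rw [e1, e2]
  have hoff : ∀ i k z, φ i k z = φ i i z * φ i k 1 := by
    intro i k z
    rcases eq_or_ne i k with rfl | hik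
    · rw [h1, mul_one]
    have e1 := cross i k z 1 1 1 hik
    simp only [mul_one, h1] at e1
    rw [e1, mul_assoc, mul_comm (φ k i 1), hinv, mul_one]
  obtain ⟨o, o', ho⟩ := exists_pair_ne n
  have hmul : φ o o Complex.I * φ o o Complex.I = -1 := by
    have e1 := cross o o' Complex.I 1 1 Complex.I ho
    simp only [one_mul, mul_one, Complex.I_mul_I, map_neg] at e1
    rw [hdiag o' o] at e1
    rw [e1, neg_mul, hinv]
  -- The array `φ i j 1` has rank one and unit diagonal, so its column `o` determines it: `φ i j 1 =
  -- d i / d j`.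
  refine ⟨fun i => φ i o 1, fun i h => ?_, ?_⟩
  · have := hinv i o
    rw [show φ i o 1 = 0 from h, zero_mul] at this
    exact zero_ne_one this
  · have hform : ∀ i j z, φ i j z = φ i o 1 * φ o o z * (φ j o 1)⁻¹ := by
      intro i j z
      have e1 : φ i j 1 = φ i o 1 * φ o j 1 := by rw [← hα, h1, mul_one]
      have e2 : (φ j o 1)⁻¹ = φ o j 1 := inv_eq_of_mul_eq_one_right (hinv j o)
      rw [hoff i j z, e1, hdiag i o, e2]
      ring
    refine (Complex.eq_id_or_conj_of_map_I_sq (h1 o) hmul).imp (fun h i j z => ?_)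
      (fun h i j z => ?_)
    · rw [hform, h]
    · rw [hform, h]

/-- Adding `α` at `(a, b)` changes the minor on rows `a, k` and columns `b, l` by `α * A k l`; both
minors vanish. -/
theorem IsOuterProduct.eq_zero_of_add_single {n K : Type*} [DecidableEq n] [Field K]
    {A : Matrix n n K} (hA : IsOuterProduct A) {a b : n} {α : K} (hα : α ≠ 0)
    (h : IsOuterProduct (A + single a b α)) {k l : n} (hk : k ≠ a) (hl : l ≠ b) : A k l = 0 := by
  have e1 := hA.cross a b k l
  have e2 := h.cross a b k l
  simp only [add_apply, single_apply, hk.symm, hl.symm, and_true, and_false,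
    if_true, if_false, add_zero, and_self] at e2
  rw [add_mul, e1, add_eq_left, mul_eq_zero] at e2
  exact e2.resolve_left hα

theorem isOuterProduct_single_add_single_same_row {n K : Type*} [DecidableEq n] [Field K]
    (i j k : n) (z w : K) : IsOuterProduct (single i j z + single i k w) := by
  refine ⟨Pi.single i 1, Pi.single j z + Pi.single k w, ?_⟩
  ext a b
  by_cases ha : i = a
  · subst ha
    simp [vecMulVec_apply, single_apply, Pi.single_apply, eq_comm]
  · simp [vecMulVec_apply, ha]

theorem IsOuterProduct.transpose {n K : Type*} [Field K] {A : Matrix n n K}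
    (hA : IsOuterProduct A) : IsOuterProduct Aᵀ := by
  obtain ⟨x, y, rfl⟩ := hA
  exact ⟨y, x, transpose_vecMulVec x y⟩

theorem isOuterProduct_single_add_single_same_col {n K : Type*} [DecidableEq n] [Field K]
    (i j k : n) (z w : K) : IsOuterProduct (single j i z + single k i w) := by
  have := (isOuterProduct_single_add_single_same_row i j k z w).transpose
  rwa [transpose_add, transpose_single, transpose_single] at this

section Normalized

variable {n : Type*} [DecidableEq n] {T : Matrix n n ℂ →ₗ[ℝ] Matrix n n ℂ}

/-- Rank one survives adding the unit at `(i, i)` (shared row) or at `(j, j)` (shared column). So a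
nonzero entry of the image lies on the cross through `(i, i)` and on the cross through `(j, j)`;
these meet only in `(i, j)` and `(j, i)`. -/
theorem map_single_apply_eq_zero (hR : ∀ A, IsOuterProduct A → IsOuterProduct (T A))
    (hd : ∀ i, T (single i i 1) = single i i 1) {i j : n} (hij : i ≠ j) (z : ℂ) {k l : n}
    (h1 : ¬(k = i ∧ l = j)) (h2 : ¬(k = j ∧ l = i)) : T (single i j z) k l = 0 := by
  have hK : IsOuterProduct (T (single i j z)) :=
    hR _ (by simpa using isOuterProduct_single_add_single_same_row i j j z 0)
  have hi : IsOuterProduct (T (single i j z) + single i i 1) := by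
    rw [← hd, ← map_add]
    exact hR _ (isOuterProduct_single_add_single_same_row ..)
  have hj : IsOuterProduct (T (single i j z) + single j j 1) := by
    rw [← hd, ← map_add]
    exact hR _ (isOuterProduct_single_add_single_same_col ..)
  by_cases h : k ≠ i ∧ l ≠ i
  · exact hK.eq_zero_of_add_single one_ne_zero hi h.1 h.2
  · refine hK.eq_zero_of_add_single one_ne_zero hj ?_ ?_ <;> grind

theorem map_single_one_eq_single_or (hinj : Function.Injective T)
    (hR : ∀ A, IsOuterProduct A → IsOuterProduct (T A))
    (hd : ∀ i, T (single i i 1) = single i i 1) {i j : n} (hij : i ≠ j) :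
    (∃ α : ℂ, α ≠ 0 ∧ T (single i j 1) = single i j α) ∨
      (∃ α : ℂ, α ≠ 0 ∧ T (single i j 1) = single j i α) := by
  have hK : IsOuterProduct (T (single i j 1)) :=
    hR _ (by simpa using isOuterProduct_single_add_single_same_row i j j (1 : ℂ) 0)
  have hz : ∀ k l, ¬(k = i ∧ l = j) → ¬(k = j ∧ l = i) → T (single i j 1) k l = 0 :=
    fun k l => map_single_apply_eq_zero hR hd hij 1
  have hne : T (single i j 1) ≠ 0 := by
    rw [Ne, map_eq_zero_iff T hinj]
    intro h
    simpa using congrFun (congrFun h i) j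
  have hprod := hK.cross i j j i
  rw [hz i i (by grind) (by grind), zero_mul, mul_eq_zero] at hprod
  rcases hprod with h | h
  · right
    have heq : T (single i j 1) = single j i (T (single i j 1) j i) := by
      ext k l
      by_cases hkl : j = k ∧ i = l
      · obtain ⟨rfl, rfl⟩ := hkl
        simp
      · rw [single_apply_of_ne _ _ _ _ _ hkl]
        grind
    refine ⟨_, fun h0 => hne ?_, heq⟩
    rw [heq, h0, single_zero]
  · left
    have heq : T (single i j 1) = single i j (T (single i j 1) i j) := by
      ext k l
      by_cases hkl : i = k ∧ j = l
      · obtain ⟨rfl, rfl⟩ := hkl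
        simp
      · rw [single_apply_of_ne _ _ _ _ _ hkl]
        grind
    refine ⟨_, fun h0 => hne ?_, heq⟩
    rw [heq, h0, single_zero]

/-- If one off-diagonal unit is mapped to a multiple of itself (and not of its transpose), then so
are all. -/
theorem map_single_one_eq_single_of_exists (hinj : Function.Injective T)
    (hR : ∀ A, IsOuterProduct A → IsOuterProduct (T A))
    (hd : ∀ i, T (single i i 1) = single i i 1) {a b : n} (hab : a ≠ b)
    (h : ∃ α : ℂ, α ≠ 0 ∧ T (single a b 1) = single a b α) {i j : n} (hij : i ≠ j) :
    ∃ α : ℂ, α ≠ 0 ∧ T (single i j 1) = single i j α := by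
  let P : n → n → Prop := fun i j => ∃ α : ℂ, α ≠ 0 ∧ T (single i j 1) = single i j α
  have hsymm : ∀ i j, i ≠ j → P i j → P j i := by
    rintro i j hij ⟨α, hα, hT⟩
    refine (map_single_one_eq_single_or hinj hR hd hij.symm).resolve_right ?_
    rintro ⟨β, hβ, hT'⟩
    -- If only one of the two units were transposed, the image of this all-ones block would have
    -- both diagonal entries `1` and a zero at `(j, i)`: a nonzero minor.
    have hM : IsOuterProduct
        (single i i 1 + single i j 1 + (single j i 1 + single j j 1) : Matrix n n ℂ) := by
      refine ⟨Pi.single i 1 + Pi.single j 1, Pi.single i 1 + Pi.single j 1, ?_⟩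
      simp only [add_vecMulVec, vecMulVec_add, ← single_eq_single_vecMulVec_single]
      abel
    have := (hR _ hM).cross i i j j
    rw [map_add, map_add, map_add, hd, hd, hT, hT'] at this
    simp [hij, hij.symm] at this
  have hrow : ∀ i j k, i ≠ j → i ≠ k → P i j → P i k := by
    rintro i j k hij hik ⟨α, hα, hT⟩
    rcases eq_or_ne j k with rfl | hjk
    · exact ⟨α, hα, hT⟩
    refine (map_single_one_eq_single_or hinj hR hd hik).resolve_right ?_
    rintro ⟨β, hβ, hT'⟩
    have := (hR _ (isOuterProduct_single_add_single_same_row i j k (1 : ℂ) 1)).cross i j k i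
    rw [map_add, hT, hT'] at this
    simp [hij, hij.symm, hik, hik.symm, hα, hβ] at this
  rcases eq_or_ne a i with rfl | hai
  · exact hrow _ _ _ hab hij h
  · exact hrow _ _ _ hai.symm hij (hsymm _ _ hai (hrow _ _ _ hab hai h))

/-- `T` is only real-linear, so its values on the units do not settle `single i j z`. Each entry off
`(i, j)` is killed by adding a unit in the same row or column whose image is already known. -/
theorem map_single_eq_single_of_exists (hinj : Function.Injective T)
    (hR : ∀ A, IsOuterProduct A → IsOuterProduct (T A))
    (hd : ∀ i, T (single i i 1) = single i i 1) {a b : n} (hab : a ≠ b)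
    (h : ∃ α : ℂ, α ≠ 0 ∧ T (single a b 1) = single a b α) (i j : n) (z : ℂ) :
    T (single i j z) = single i j (T (single i j z) i j) := by
  have hK : IsOuterProduct (T (single i j z)) :=
    hR _ (by simpa using isOuterProduct_single_add_single_same_row i j j z 0)
  have hP {i j : n} (hij : i ≠ j) := map_single_one_eq_single_of_exists hinj hR hd hab h hij
  ext k l
  by_cases hkl : i = k ∧ j = l
  · obtain ⟨rfl, rfl⟩ := hkl
    simp
  rw [single_apply_of_ne _ _ _ _ _ hkl]
  rcases eq_or_ne i j with rfl | hij
  · rcases eq_or_ne k i with rfl | hki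
    · have hlk : l ≠ k := by grind
      obtain ⟨α, hα, hT⟩ := hP hlk
      refine hK.eq_zero_of_add_single hα ?_ hlk.symm hlk
      rw [← hT, ← map_add]
      exact hR _ (isOuterProduct_single_add_single_same_col ..)
    · rcases eq_or_ne l i with rfl | hli
      · obtain ⟨α, hα, hT⟩ := hP hki.symm
        refine hK.eq_zero_of_add_single hα ?_ hki hki.symm
        rw [← hT, ← map_add]
        exact hR _ (isOuterProduct_single_add_single_same_row ..)
      · refine hK.eq_zero_of_add_single one_ne_zero ?_ hki hli
        rw [← hd, ← map_add]
        exact hR _ (isOuterProduct_single_add_single_same_row ..)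
  · by_cases hlk : k = j ∧ l = i
    · obtain ⟨rfl, rfl⟩ := hlk
      obtain ⟨α, hα, hT⟩ := hP hij
      refine hK.eq_zero_of_add_single hα ?_ hij.symm hij
      rw [← hT, ← map_add]
      exact hR _ (isOuterProduct_single_add_single_same_row ..)
    · exact map_single_apply_eq_zero hR hd hij z (by grind) hlk

theorem exists_diagonal_of_map_single [Fintype n] (hinj : Function.Injective T)
    (hR : ∀ A, IsOuterProduct A → IsOuterProduct (T A))
    (hd : ∀ i, T (single i i 1) = single i i 1) {a b : n} (hab : a ≠ b)
    (h : ∃ α : ℂ, α ≠ 0 ∧ T (single a b 1) = single a b α) :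
    ∃ d : n → ℂ, (∀ i, d i ≠ 0) ∧ ((∀ A i j, T A i j = d i * A i j * (d j)⁻¹) ∨
      (∀ A i j, T A i j = d i * starRingEnd ℂ (A i j) * (d j)⁻¹)) := by
  have : Nontrivial n := ⟨a, b, hab⟩
  let φ : n → n → ℂ →ₗ[ℝ] ℂ := fun i j =>
    entryLinearMap ℝ ℂ i j ∘ₗ T ∘ₗ singleLinearMap ℝ i j
  have hφ : ∀ A i j, T A i j = φ i j (A i j) := by
    intro A i j
    conv_lhs => rw [matrix_eq_sum_single A]
    simp only [map_sum, sum_apply]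
    rw [Finset.sum_eq_single i, Finset.sum_eq_single j]
    · rfl
    · intro l _ hl
      rw [map_single_eq_single_of_exists hinj hR hd hab h]
      exact single_apply_of_ne _ _ _ _ _ (by simp [hl])
    · simp
    · intro k _ hk
      refine Finset.sum_eq_zero fun l _ => ?_
      rw [map_single_eq_single_of_exists hinj hR hd hab h]
      exact single_apply_of_ne _ _ _ _ _ (by simp [hk])
    · simp
  obtain ⟨d, hd0, hdφ⟩ := exists_diagonal_of_cross (φ := φ)
    (fun i => by
      have := hφ (single i i 1) i i
      rw [hd] at this
      simpa using this.symm)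
    (fun x y i j k l => by
      have := (hR _ ⟨x, y, rfl⟩).cross i j k l
      simpa only [hφ, vecMulVec_apply] using this)
  refine ⟨d, hd0, hdφ.imp (fun h A i j => ?_) (fun h A i j => ?_)⟩
  · rw [hφ, h]
  · rw [hφ, h]

theorem exists_diagonal_of_map_single_diag [Fintype n] [Nontrivial n]
    (hinj : Function.Injective T)
    (hR : ∀ A, IsOuterProduct A → IsOuterProduct (T A))
    (hd : ∀ i, T (single i i 1) = single i i 1) :
    ∃ U : GL n ℂ, (∀ A, T A = U.val * A * U⁻¹.val) ∨ (∀ A, T A = U.val * Aᵀ * U⁻¹.val) ∨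
      (∀ A, T A = U.val * A.map (starRingEnd ℂ) * U⁻¹.val) ∨
      (∀ A, T A = U.val * (A.map (starRingEnd ℂ))ᵀ * U⁻¹.val) := by
  have hU : ∀ d : n → ℂ, (∀ i, d i ≠ 0) → ∃ U : GL n ℂ,
      ∀ (A : Matrix n n ℂ) (i j : n), (U.val * A * U⁻¹.val) i j = d i * A i j * (d j)⁻¹ := by
    intro d hd0
    refine ⟨⟨diagonal d, diagonal d⁻¹, ?_, ?_⟩, fun A i j => ?_⟩
    · rw [diagonal_mul_diagonal, ← diagonal_one]
      congr 1
      ext i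
      simp [hd0 i]
    · rw [diagonal_mul_diagonal, ← diagonal_one]
      congr 1
      ext i
      simp [hd0 i]
    · rw [Units.inv_mk, mul_diagonal, diagonal_mul]
      rfl
  obtain ⟨a, b, hab⟩ := exists_pair_ne n
  rcases map_single_one_eq_single_or hinj hR hd hab with h | ⟨α, hα, h⟩
  · obtain ⟨d, hd0, hdT⟩ := exists_diagonal_of_map_single hinj hR hd hab h
    obtain ⟨U, hU⟩ := hU d hd0
    refine ⟨U, ?_⟩
    rcases hdT with hT | hT
    · exact Or.inl fun A => by ext i j; rw [hT, hU]
    · exact Or.inr (Or.inr (Or.inl fun A => by ext i j; rw [hT, hU, map_apply]))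
  -- Composing with the transpose reduces to the previous case; undoing it swaps the roles of `d`
  -- and `d⁻¹`.
  · let T' : Matrix n n ℂ →ₗ[ℝ] Matrix n n ℂ := (transposeLinearEquiv n n ℝ ℂ).toLinearMap ∘ₗ T
    have hT' : ∀ A, T' A = (T A)ᵀ := fun A => rfl
    obtain ⟨d, hd0, hdT⟩ := exists_diagonal_of_map_single (T := T')
      ((transposeLinearEquiv n n ℝ ℂ).injective.comp hinj)
      (fun A hA => (hR A hA).transpose)
      (fun i => by rw [hT', hd, transpose_single]) hab
      ⟨α, hα, by rw [hT', h, transpose_single]⟩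
    obtain ⟨U, hU⟩ := hU d⁻¹ (fun i => by simpa using hd0 i)
    refine ⟨U, ?_⟩
    rcases hdT with hT | hT
    · refine Or.inr (Or.inl fun A => ?_)
      ext i j
      have := hT A j i
      rw [hT', transpose_apply] at this
      rw [this, hU, transpose_apply, Pi.inv_apply, Pi.inv_apply, inv_inv]
      ring
    · refine Or.inr (Or.inr (Or.inr fun A => ?_))
      ext i j
      have := hT A j i
      rw [hT', transpose_apply] at this
      rw [this, hU, transpose_apply, map_apply, Pi.inv_apply, Pi.inv_apply, inv_inv]
      ring

end Normalized

/-! ### Unital preservers of invertibility. -/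

/-- Unital real-linear bijections of the matrix algebra preserving invertibility in both
directions. -/
theorem exists_conj_of_det_ne_zero_iff {n : Type*} [Fintype n] [DecidableEq n] [Nontrivial n]
    {T : Matrix n n ℂ ≃ₗ[ℝ] Matrix n n ℂ} (hT : ∀ A, (T A).det ≠ 0 ↔ A.det ≠ 0) (h1 : T 1 = 1) :
    ∃ U : GL n ℂ, (∀ A, T A = U.val * A * U⁻¹.val) ∨ (∀ A, T A = U.val * Aᵀ * U⁻¹.val) ∨
      (∀ A, T A = U.val * A.map (starRingEnd ℂ) * U⁻¹.val) ∨
      (∀ A, T A = U.val * (A.map (starRingEnd ℂ))ᵀ * U⁻¹.val) := by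
  have hR : ∀ A, IsOuterProduct A → IsOuterProduct (T A) :=
    fun A => isOuterProduct_map_of_det_ne_zero_iff hT
  have hp : ∀ i, IsOuterProduct (T (single i i 1)) := fun i =>
    hR _ ⟨_, _, single_eq_single_vecMulVec_single i i⟩
  choose x y hxy using hp
  -- The rank-one images `vecMulVec (x i) (y i)` sum to `T 1 = 1`. Hence the matrix with columns `x
  -- i` has as inverse the matrix with rows `y i`, and conjugating by it returns these images to the
  -- diagonal units.
  have hXY : (of x)ᵀ * of y = 1 := by
    have hone : ∑ i, single i i 1 = (1 : Matrix n n ℂ) := by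
      rw [sum_single_eq_diagonal (fun _ => (1 : ℂ)), ← diagonal_one]
    rw [← h1, ← hone, map_sum]
    simp only [hxy]
    ext i j
    simp [mul_apply, sum_apply, vecMulVec_apply]
  let V : GL n ℂ := ⟨(of x)ᵀ, of y, hXY, mul_eq_one_comm.1 hXY⟩
  have hV1 : V⁻¹.val * V.val = 1 := by rw [← Units.val_mul, inv_mul_cancel, Units.val_one]
  have hV2 : V.val * V⁻¹.val = 1 := by rw [← Units.val_mul, mul_inv_cancel, Units.val_one]
  let c : Matrix n n ℂ →ₗ[ℝ] Matrix n n ℂ :=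
    LinearMap.mulLeft ℝ V⁻¹.val ∘ₗ LinearMap.mulRight ℝ V.val
  have hc : ∀ A, c A = V⁻¹.val * (A * V.val) := fun A => rfl
  have hTc : ∀ A, V.val * c A * V⁻¹.val = A := by
    intro A
    rw [hc, ← Matrix.mul_assoc, hV2, Matrix.one_mul, Matrix.mul_assoc, hV2, Matrix.mul_one]
  obtain ⟨U, hU⟩ := exists_diagonal_of_map_single_diag (T := c ∘ₗ T.toLinearMap)
    (by
      refine Function.Injective.comp (g := c) (fun A B h => ?_) T.injective
      rw [← hTc A, h, hTc])
    (fun A hA => by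
      obtain ⟨u, v, huv⟩ := hR A hA
      refine ⟨V⁻¹.val *ᵥ u, v ᵥ* V.val, ?_⟩
      rw [LinearMap.comp_apply, LinearEquiv.coe_coe, huv, hc, vecMulVec_mul, mul_vecMulVec])
    (fun i => by
      rw [LinearMap.comp_apply, LinearEquiv.coe_coe, hxy, hc, vecMulVec_mul, mul_vecMulVec,
        single_eq_single_vecMulVec_single]
      have e1 : V⁻¹.val *ᵥ x i = Pi.single i 1 := by
        have : x i = V.val *ᵥ Pi.single i 1 := by
          rw [mulVec_single_one]
          rfl
        rw [this, mulVec_mulVec, hV1, one_mulVec]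
      have e2 : y i ᵥ* V.val = Pi.single i 1 := by
        have : y i = Pi.single i 1 ᵥ* V⁻¹.val := by
          rw [single_one_vecMul]
          rfl
        rw [this, vecMul_vecMul, hV1, vecMul_one]
      rw [e1, e2])
  have key : ∀ A B, (c ∘ₗ T.toLinearMap) A = U.val * B * U⁻¹.val →
      T A = (V * U).val * B * (V * U)⁻¹.val := by
    intro A B h
    rw [← hTc (T A), show c (T A) = _ from h, _root_.mul_inv_rev, Units.val_mul, Units.val_mul]
    simp only [Matrix.mul_assoc]
  refine ⟨V * U, ?_⟩
  rcases hU with h | h | h | h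
  · exact Or.inl fun A => key _ _ (h A)
  · exact Or.inr (Or.inl fun A => key _ _ (h A))
  · exact Or.inr (Or.inr (Or.inl fun A => key _ _ (h A)))
  · exact Or.inr (Or.inr (Or.inr fun A => key _ _ (h A)))

end Matrix

/-! ### Isometries, including size one, and the final assembly. -/

theorem Complex.eq_id_or_conj_of_norm_eq {σ : ℂ →ₗ[ℝ] ℂ} (h1 : σ 1 = 1)
    (hσ : ∀ z, ‖σ z‖ = ‖z‖) : (∀ z, σ z = z) ∨ (∀ z, σ z = starRingEnd ℂ z) := by
  refine Complex.eq_id_or_conj_of_map_I_sq h1 ?_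
  -- The norms of `σ I` and `1 + σ I` force `σ I` to be purely imaginary of modulus one.
  have e1 := congrArg (· ^ 2) (hσ I)
  have e2 := congrArg (· ^ 2) (hσ (1 + I))
  rw [map_add, h1] at e2
  simp only [Complex.sq_norm, Complex.normSq_apply, Complex.add_re, Complex.add_im, Complex.one_re,
    Complex.one_im, Complex.I_re, Complex.I_im] at e1 e2
  have hre : (σ I).re = 0 := by linarith
  rw [hre] at e1
  apply Complex.ext
  · simp only [Complex.mul_re, hre, Complex.neg_re, Complex.one_re]
    linarith
  · simp [hre]

namespace Matrix

/-- Real-linear isometries of the one-dimensional matrix algebra. -/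
theorem eq_mul_or_mul_conj_of_unique {n : Type*} [Fintype n] [DecidableEq n] [Unique n]
    {ν ν' : AlgebraNorm ℂ (Matrix n n ℂ)} {T : Matrix n n ℂ →ₗ[ℝ] Matrix n n ℂ}
    (hT : ∀ A, ν' (T A) = ν A) :
    (∀ A, T A = T 1 * A) ∨ (∀ A, T A = T 1 * A.map (starRingEnd ℂ)) := by
  have hsmul : ∀ A : Matrix n n ℂ, A = A default default • (1 : Matrix n n ℂ) := by
    intro A
    ext i j
    simp [Subsingleton.elim i default, Subsingleton.elim j default]
  -- In size one every norm is a multiple of the absolute value.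
  have hν : ∀ (μ : AlgebraNorm ℂ (Matrix n n ℂ)) A, μ A = ‖A default default‖ * μ 1 := by
    intro μ A
    conv_lhs => rw [hsmul A]
    rw [map_smul_eq_mul]
  have hν0 : ∀ μ : AlgebraNorm ℂ (Matrix n n ℂ), μ 1 ≠ 0 := by
    intro μ h
    exact one_ne_zero (eq_zero_of_map_eq_zero μ h)
  let t : ℂ := T 1 default default
  have ht : ‖t‖ * ν' 1 = ν 1 := by rw [← hν, hT]
  have ht0 : t ≠ 0 := by
    intro h
    rw [h, norm_zero, zero_mul] at ht
    exact hν0 ν ht.symm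
  let σ : ℂ →ₗ[ℝ] ℂ := LinearMap.mulLeft ℝ t⁻¹ ∘ₗ entryLinearMap ℝ ℂ default default ∘ₗ T ∘ₗ
    singleLinearMap ℝ default default
  have hsingle : ∀ A : Matrix n n ℂ, single default default (A default default) = A := by
    intro A
    ext i j
    simp [Subsingleton.elim i default, Subsingleton.elim j default]
  have hσ : ∀ A, σ (A default default) = t⁻¹ * T A default default := by
    intro A
    change t⁻¹ * T (single default default (A default default)) default default = _
    rw [hsingle]
  have hTσ : ∀ A, T A default default = t * σ (A default default) := by
    intro A
    rw [hσ, mul_inv_cancel_left₀ ht0]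
  have h1 : σ 1 = 1 := by
    have := hσ 1
    rw [one_apply_eq] at this
    rw [this, inv_mul_cancel₀ ht0]
  have hnorm : ∀ z, ‖σ z‖ = ‖z‖ := by
    intro z
    have h := hT (single default default z)
    rw [hν ν', hν ν, hTσ, single_apply_same, norm_mul, ← ht] at h
    refine mul_right_cancel₀ (hν0 ν) ?_
    rw [← ht]
    linarith
  have hext : ∀ A B : Matrix n n ℂ, A default default = B default default → A = B := by
    intro A B h
    rw [hsmul A, h, ← hsmul B]
  refine (Complex.eq_id_or_conj_of_norm_eq h1 hnorm).imp (fun h A => hext _ _ ?_)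
    (fun h A => hext _ _ ?_)
  · rw [hTσ, h, mul_apply, Fintype.sum_unique]
  · rw [hTσ, h, mul_apply, Fintype.sum_unique, map_apply]

/-- Real-linear isometries of matrix algebras preserving invertibility in both directions. -/
theorem exists_mul_conj_of_isometry {n : ℕ} {ν ν' : AlgebraNorm ℂ (Matrix (Fin n) (Fin n) ℂ)}
    {T : Matrix (Fin n) (Fin n) ℂ ≃ₗ[ℝ] Matrix (Fin n) (Fin n) ℂ}
    (hν : ∀ A, ν' (T A) = ν A) (hT : ∀ A, (T A).det ≠ 0 ↔ A.det ≠ 0) {W : GL (Fin n) ℂ}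
    (hW : T 1 = W.val) :
    ∃ U : GL (Fin n) ℂ, (∀ A, T A = W.val * U.val * A * U⁻¹.val) ∨
      (∀ A, T A = W.val * U.val * Aᵀ * U⁻¹.val) ∨
      (∀ A, T A = W.val * U.val * A.map (starRingEnd ℂ) * U⁻¹.val) ∨
      (∀ A, T A = W.val * U.val * (A.map (starRingEnd ℂ))ᵀ * U⁻¹.val) := by
  match n with
  | 0 => exact ⟨1, Or.inl fun A => Subsingleton.elim _ _⟩
  | 1 =>
    have := eq_mul_or_mul_conj_of_unique (T := T.toLinearMap) hν
    rw [LinearEquiv.coe_coe, hW] at this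
    refine ⟨1, this.elim (fun h => Or.inl fun A => ?_)
      (fun h => Or.inr (Or.inr (Or.inl fun A => ?_)))⟩
    · simpa using h A
    · simpa using h A
  | n + 2 =>
    have hW1 : W⁻¹.val * W.val = 1 := by rw [← Units.val_mul, inv_mul_cancel, Units.val_one]
    have hW2 : W.val * W⁻¹.val = 1 := by rw [← Units.val_mul, mul_inv_cancel, Units.val_one]
    let L : Matrix (Fin (n + 2)) (Fin (n + 2)) ℂ ≃ₗ[ℝ] Matrix (Fin (n + 2)) (Fin (n + 2)) ℂ :=
      LinearEquiv.ofLinearMap (LinearMap.mulLeft ℝ W⁻¹.val) (LinearMap.mulLeft ℝ W.val)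
        (by rw [← LinearMap.mulLeft_mul, hW1, LinearMap.mulLeft_one])
        (by rw [← LinearMap.mulLeft_mul, hW2, LinearMap.mulLeft_one])
    have hL : ∀ A, (T.trans L) A = W⁻¹.val * T A := fun A => rfl
    have hLT : ∀ A, T A = W.val * (T.trans L) A := by
      intro A
      rw [hL, ← Matrix.mul_assoc, hW2, Matrix.one_mul]
    have hdet : W⁻¹.val.det ≠ 0 := ((isUnit_iff_isUnit_det _).1 W⁻¹.isUnit).ne_zero
    obtain ⟨U, hU⟩ := exists_conj_of_det_ne_zero_iff (T := T.trans L)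
      (fun A => by rw [hL, det_mul, ← hT, mul_ne_zero_iff, and_iff_right hdet])
      (by rw [hL, hW, hW1])
    refine ⟨U, ?_⟩
    simp only [hLT, Matrix.mul_assoc] at hU ⊢
    rcases hU with h | h | h | h
    · exact Or.inl fun A => by rw [h]
    · exact Or.inr (Or.inl fun A => by rw [h])
    · exact Or.inr (Or.inr (Or.inl fun A => by rw [h]))
    · exact Or.inr (Or.inr (Or.inr fun A => by rw [h]))

theorem conj_mul_conj {n : Type*} [Fintype n] [DecidableEq n] (U : GL n ℂ) (A B : Matrix n n ℂ) :
    U.val * A * U⁻¹.val * (U.val * B * U⁻¹.val) = U.val * (A * B) * U⁻¹.val := by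
  simp only [Matrix.mul_assoc]
  rw [← Matrix.mul_assoc U⁻¹.val, ← Units.val_mul, inv_mul_cancel, Units.val_one, Matrix.one_mul]

/-- A surjective isometry between open subgroups is the restriction of a real-linear isometry
preserving invertibility in both directions. -/
theorem exists_linearEquiv_of_isometry {n : Type*} [Fintype n] [DecidableEq n]
    (ν ν' : AlgebraNorm ℂ (Matrix n n ℂ)) (𝔄 𝔅 : OpenSubgroup (GL n ℂ))
    (S : 𝔄 → 𝔅) (hsurj : Function.Surjective S)
    (hiso : ∀ M N : 𝔄, ν' ((S M : GL n ℂ).val - (S N : GL n ℂ).val) =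
      ν ((M : GL n ℂ).val - (N : GL n ℂ).val)) :
    ∃ T : Matrix n n ℂ ≃ₗ[ℝ] Matrix n n ℂ, (∀ A, ν' (T A) = ν A) ∧
      (∀ A, (T A).det ≠ 0 ↔ A.det ≠ 0) ∧ ∀ M : 𝔄, T (M : GL n ℂ).val = (S M : GL n ℂ).val := by
  have hreal : ∀ (μ : AlgebraNorm ℂ (Matrix n n ℂ)) (r : ℝ) (A : Matrix n n ℂ),
      μ (r • A) = |r| * μ A := by
    intro μ r A
    rw [← Complex.coe_smul, map_smul_eq_mul, Complex.norm_real, Real.norm_eq_abs]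
  have hB : ∀ g : GL n ℂ, ∃ M : 𝔄, (S M : GL n ℂ) = g := by
    intro g
    obtain ⟨M, hM⟩ := hsurj ⟨g, mem_openSubgroup_GL 𝔅 g⟩
    exact ⟨M, by rw [hM]⟩
  obtain ⟨T, c, hν, hTc⟩ := exists_affine_of_addGroupNorm ν.toRingNorm.toAddGroupNorm
    ν'.toRingNorm.toAddGroupNorm (hreal ν) (hreal ν')
    (a := fun M : 𝔄 => (M : GL n ℂ).val) (b := fun M : 𝔄 => (S M : GL n ℂ).val)
    (fun A ε hε => by
      obtain ⟨g, hg⟩ := exists_GL_sub_lt ν A hε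
      exact ⟨⟨g, mem_openSubgroup_GL 𝔄 g⟩, hg⟩)
    (fun A ε hε => by
      obtain ⟨g, hg⟩ := exists_GL_sub_lt ν' A hε
      obtain ⟨M, rfl⟩ := hB g
      exact ⟨M, hg⟩)
    hiso
  have hunit : ∀ g : GL n ℂ, g.val.det ≠ 0 := fun g =>
    ((isUnit_iff_isUnit_det _).1 g.isUnit).ne_zero
  have hdet : ∀ A, (T A + c).det ≠ 0 ↔ A.det ≠ 0 := by
    intro A
    constructor
    -- `S` reaches every invertible matrix, so an invertible `T A + c` is some `S M`, and
    -- injectivity of `T` gives `A = M`.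
    · intro h
      obtain ⟨M, hM⟩ := hB (GeneralLinearGroup.mkOfDetNeZero _ h)
      have h1 : (S M : GL n ℂ).val = T A + c := by rw [hM]; rfl
      rw [← hTc, add_left_inj] at h1
      rw [← T.injective h1]
      exact hunit _
    · intro h
      have := hTc ⟨GeneralLinearGroup.mkOfDetNeZero A h, mem_openSubgroup_GL 𝔄 _⟩
      rw [show T A + c = _ from this]
      exact hunit _
  obtain rfl := translation_eq_zero_of_det_ne_zero_iff hdet
  exact ⟨T, hν, by simpa using hdet, by simpa using hTc⟩

end Matrix
theorem corollary5p5 (n : ℕ)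
    (ν ν' : AlgebraNorm ℂ (Matrix (Fin n) (Fin n) ℂ))
    (𝔄 𝔅 : OpenSubgroup (GL (Fin n) ℂ))
    (S : 𝔄 → 𝔅) (hsurj : Function.Surjective S)
    (hiso : ∀ M N : 𝔄,
      ν' (((S M : GL (Fin n) ℂ) : Matrix (Fin n) (Fin n) ℂ) - (S N : GL (Fin n) ℂ)) =
        ν (((M : GL (Fin n) ℂ) : Matrix (Fin n) (Fin n) ℂ) - (N : GL (Fin n) ℂ))) :
    (∃ U : GL (Fin n) ℂ,
      (∀ M : 𝔄, ((S M : GL (Fin n) ℂ) : Matrix (Fin n) (Fin n) ℂ) =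
        (S 1 : GL (Fin n) ℂ).val * U.val * (M : GL (Fin n) ℂ).val * U⁻¹.val) ∨
      (∀ M : 𝔄, ((S M : GL (Fin n) ℂ) : Matrix (Fin n) (Fin n) ℂ) =
        (S 1 : GL (Fin n) ℂ).val * U.val * (M : GL (Fin n) ℂ).valᵀ * U⁻¹.val) ∨
      (∀ M : 𝔄, ((S M : GL (Fin n) ℂ) : Matrix (Fin n) (Fin n) ℂ) =
        (S 1 : GL (Fin n) ℂ).val * U.val *
          (M : GL (Fin n) ℂ).val.map (starRingEnd ℂ) * U⁻¹.val) ∨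
      (∀ M : 𝔄, ((S M : GL (Fin n) ℂ) : Matrix (Fin n) (Fin n) ℂ) =
        (S 1 : GL (Fin n) ℂ).val * U.val *
          ((M : GL (Fin n) ℂ).val.map (starRingEnd ℂ))ᵀ * U⁻¹.val)) ∧
    (S 1 = 1 →
      (∀ M N : 𝔄, S (M * N) = S M * S N) ∨ (∀ M N : 𝔄, S (M * N) = S N * S M)) := by

  obtain ⟨T, hν, hdet, hTS⟩ := Matrix.exists_linearEquiv_of_isometry ν ν' 𝔄 𝔅 S hsurj hiso
  obtain ⟨U, hU⟩ := Matrix.exists_mul_conj_of_isometry hν hdet (W := S 1) (hTS 1)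
  refine ⟨⟨U, ?_⟩, fun h1 => ?_⟩
  · exact hU.imp (fun h M => (hTS M).symm.trans (h _))
      (Or.imp (fun h M => (hTS M).symm.trans (h _))
        (Or.imp (fun h M => (hTS M).symm.trans (h _)) fun h M => (hTS M).symm.trans (h _)))
  · have hmul : (∀ M N : 𝔄, T (M * N : GL (Fin n) ℂ).val =
        T (M : GL (Fin n) ℂ).val * T (N : GL (Fin n) ℂ).val) →
        ∀ M N : 𝔄, S (M * N) = S M * S N := by
      intro h M N
      apply Subtype.ext
      apply Units.ext
      simpa [hTS] using (hTS (M * N)).symm.trans (h M N)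
    have hanti : (∀ M N : 𝔄, T (M * N : GL (Fin n) ℂ).val =
        T (N : GL (Fin n) ℂ).val * T (M : GL (Fin n) ℂ).val) →
        ∀ M N : 𝔄, S (M * N) = S N * S M := by
      intro h M N
      apply Subtype.ext
      apply Units.ext
      simpa [hTS] using (hTS (M * N)).symm.trans (h M N)
    rw [h1] at hU
    simp only [OneMemClass.coe_one, Units.val_one, Matrix.one_mul] at hU
    rcases hU with h | h | h | h
    · refine Or.inl (hmul fun M N => ?_)
      rw [h, h, h, Matrix.conj_mul_conj, Units.val_mul]
    · refine Or.inr (hanti fun M N => ?_)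
      rw [h, h, h, Matrix.conj_mul_conj, Units.val_mul, Matrix.transpose_mul]
    · refine Or.inl (hmul fun M N => ?_)
      rw [h, h, h, Matrix.conj_mul_conj, Units.val_mul, Matrix.map_mul]
    · refine Or.inr (hanti fun M N => ?_)
      rw [h, h, h, Matrix.conj_mul_conj, Units.val_mul, Matrix.map_mul, Matrix.transpose_mul]
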